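/- For a rational number $x=a/b$ in lowest terms ($b\ge 1$) let $\mathrm{bits}(x)=\lceil\log_2(|a|+1)\rceil+\lceil\log_2(b+1)\rceil$, and let $\mathrm{bits}(x)=\infty$ for irrational $x$. A simple polygon is identified with the closed bounded region $P\subset\mathbb{R}^2$ enclosed by it. For $s,t\in P$, an $s$–$t$ path with $k$ links is a sequence $s=p_0,p_1,\dots,p_k=t$ of points such that every segment $p_{i-1}p_i$ is contained in $P$; the points $p_1,\dots,p_{k-1}$ are its bends. A minimum-link path is one with the smallest number of links in the class of paths under consideration; this number is the link distance of $s$ and $t$. There are constants $C,c,\delta>0$ and $N\in\mathbb{N}$ such that for every integer $n\ge N$ there are a simple polygon $P$ with $n$ vertices and points $s,t\in P$ such that (i) all coordinates of the vertices of $P$ and of $s$ and $t$ have at most $C\log n$ bits; (ii) the link distance $k$ of $s$ and $t$ in $P$ satisfies $k\ge\delta n$, and every minimum-link $s$–$t$ path in $P$ has a bend with a coordinate that needs more than $c\,k\log n$ bits. The same assertion (possibly with other constants, and another polygon and other points) holds when the path is only allowed to bend on the edges of $P$: then $s$ and $t$ lie on the boundary of $P$, all bends must lie on the boundary of $P$ (the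 links may pass through the interior of $P$), and both the link distance $k$ and the notion of minimum-link path refer to this restricted class of paths. -/

import Mathlib

namespace MinLink

/-- A polygon is *simple* if it has at least three vertices, no edge is degenerate, and two distinct
edges meet only when they are cyclically consecutive, and then only in their common vertex. -/
def IsSimple {n : ℕ} (P : Polygon (ℝ × ℝ) n) : Prop :=
  3 ≤ n ∧ P.HasNondegenerateEdges ∧
    ∀ i j : Fin n, i ≠ j → ∀ x ∈ P.edgeSet ℝ i ∩ P.edgeSet ℝ j,
      (j = finRotate n i ∧ x = P j) ∨ (i = finRotate n j ∧ x = P i)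

/-- `D` is the closed region bounded by the polygon `P`: a compact set, equal to the closure of its
interior, whose topological boundary is the union of the edges of `P`.

For a simple polygon there is exactly one such set, the boundary curve together with its inside:
`interior D` is closed and open in the complement of the curve, it is nonempty, and it is bounded,
so by the Jordan curve theorem it is the bounded component of that complement. -/
def IsRegion {n : ℕ} (P : Polygon (ℝ × ℝ) n) (D : Set (ℝ × ℝ)) : Prop :=
  IsCompact D ∧ closure (interior D) = D ∧ frontier D = P.boundary ℝ

/-- `p 0, …, p k` are the successive vertices of a polygonal `s`–`t` path with `k` links.
All vertices of the path (the endpoints and the bends) lie in `A`, all links lie in `D`. -/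
def IsLinkPath (A D : Set (ℝ × ℝ)) (s t : ℝ × ℝ) (k : ℕ) (p : Fin (k + 1) → ℝ × ℝ) : Prop :=
  p 0 = s ∧ p (Fin.last k) = t ∧ (∀ i, p i ∈ A) ∧
    ∀ i : Fin k, segment ℝ (p i.castSucc) (p i.succ) ⊆ D

/-- `k` is the smallest number of links of an `s`–`t` path with vertices in `A` and links in `D`
(in particular such a path exists). -/
def IsLinkDist (A D : Set (ℝ × ℝ)) (s t : ℝ × ℝ) (k : ℕ) : Prop :=
  IsLeast {m : ℕ | ∃ p : Fin (m + 1) → ℝ × ℝ, IsLinkPath A D s t m p} k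

/-- The number of binary digits of the numerator and the denominator of a rational number in lowest
terms: `⌈log₂ (|a| + 1)⌉ + ⌈log₂ (b + 1)⌉` for `a / b`. -/
def ratBits (q : ℚ) : ℕ :=
  Nat.size q.num.natAbs + Nat.size q.den

/-- The real number `x` is rational and can be represented with at most `B` bits.
An irrational number cannot be represented with any number of bits. -/
def Representable (x B : ℝ) : Prop :=
  ∃ q : ℚ, (q : ℝ) = x ∧ (ratBits q : ℝ) ≤ B

/-- Both coordinates of the point `x` can be represented with at most `B` bits each. -/
def PointRepresentable (x : ℝ × ℝ) (B : ℝ) : Prop :=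
  Representable x.1 B ∧ Representable x.2 B

end MinLink

open Set Topology

/-! The polygon is a thin corridor along the parabola `2 r y = x ^ 2`, with `r = n`. Its lower wall
is the maximum of the tangents at `x = 2 r i`, `0 ≤ i ≤ 2 m`. Its upper wall joins gates, the `i`-th
one lying on the chord between tangent points `i` and `i + 1`, at horizontal distance `a` from the
left one. Call `x - 2 r i` the advance of a point relative to tangent point `i`.

A link that starts at advance at most `α` and passes below gate `i` ends at an advance `w` relative
to `i + 1` with `w (a - 2 α) ≤ α (2 r - a)`, provided `2 α < a` (`link_advance`). In the first half
`a = 2 r - 1`, so each link divides the possible advance by at least `r` (`advance_le`). In the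
second half `a = 1`, so the advance can grow back. In both halves a nonpositive advance stays
nonpositive (`lag`).

The start has advance 1 at tangent point `0`, the target advance 1 at tangent point `2 m`. Hence `2
m` links are necessary; they also suffice, with all bends on the lower wall (`isLinkPath_bend`). The
middle bend of any path with `2 m` links has an abscissa strictly above the integer `2 r m`, by at
most `r ^ (-m)`. A rational number of this kind has denominator at least `r ^ m`
(`not_representable_of_near_int`), hence of order `m log r` bits, while all input coordinates are
integers polynomial in `n`.

The lower bounds hold for arbitrary bends in the region and the optimal path bends on the boundary,
so one polygon serves both assertions. -/

namespace MinLink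

/-! ### Piecewise linear interpolation -/

/-- The continuous piecewise linear function through the points `(X j, Y j)`, `j ≤ M`, extended by
constants. -/
noncomputable def interp (X Y : ℕ → ℝ) (M : ℕ) (x : ℝ) : ℝ :=
  Y 0 + ∑ j ∈ Finset.range M,
    -- The clamped difference is the length of the part of piece `j` to the left of `x`.
    (Y (j + 1) - Y j) / (X (j + 1) - X j) * (max (X j) (min x (X (j + 1))) - X j)

theorem continuous_interp (X Y : ℕ → ℝ) (M : ℕ) : Continuous (interp X Y M) := by
  unfold interp
  fun_prop

theorem interp_succ (X Y : ℕ → ℝ) (M : ℕ) (x : ℝ) :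
    interp X Y (M + 1) x = interp X Y M x +
      (Y (M + 1) - Y M) / (X (M + 1) - X M) * (max (X M) (min x (X (M + 1))) - X M) := by
  unfold interp
  rw [Finset.sum_range_succ]
  ring

theorem interp_of_ge {X Y : ℕ → ℝ} {M : ℕ} (hX : ∀ i < M, X i < X (i + 1)) {x : ℝ}
    (hx : X M ≤ x) : interp X Y M x = Y M := by
  induction M with
  | zero => simp [interp]
  | succ M ih =>
    have h := hX M (Nat.lt_succ_self M)
    rw [interp_succ, ih (fun i hi => hX i (hi.trans (Nat.lt_succ_self M))) (h.le.trans hx),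
      min_eq_right hx, max_eq_right h.le, div_mul_cancel₀ _ (sub_pos.2 h).ne']
    ring

theorem strictMonoOn_of_step {X : ℕ → ℝ} {M : ℕ} (hX : ∀ i < M, X i < X (i + 1)) :
    StrictMonoOn X (Iic M) :=
  strictMonoOn_Iic_of_lt_succ hX

/-- On each piece, `interp` is the linear interpolation of the two end values. -/
theorem interp_eq {X Y : ℕ → ℝ} {M : ℕ} (hX : ∀ i < M, X i < X (i + 1)) {i : ℕ} (hi : i < M)
    {x : ℝ} (h₁ : X i ≤ x) (h₂ : x ≤ X (i + 1)) :
    interp X Y M x = Y i + (Y (i + 1) - Y i) / (X (i + 1) - X i) * (x - X i) := by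
  induction M with
  | zero => omega
  | succ M ih =>
    have hX' : ∀ i < M, X i < X (i + 1) := fun i hi => hX i (hi.trans (Nat.lt_succ_self M))
    rw [interp_succ]
    rcases Nat.lt_succ_iff_lt_or_eq.1 hi with h | rfl
    · have hM : x ≤ X M := h₂.trans
        ((strictMonoOn_of_step hX').monotoneOn (mem_Iic.2 h) (mem_Iic.2 le_rfl) h)
      rw [ih hX' h, max_eq_left ((min_le_left _ _).trans hM)]
      ring
    · rw [interp_of_ge hX' h₁, min_eq_left h₂, max_eq_right h₁]

theorem interp_node {X Y : ℕ → ℝ} {M : ℕ} (hX : ∀ i < M, X i < X (i + 1)) {i : ℕ} (hi : i ≤ M) :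
    interp X Y M (X i) = Y i := by
  rcases hi.lt_or_eq with h | rfl
  · rw [interp_eq hX h le_rfl (hX i h).le]
    ring
  · exact interp_of_ge hX le_rfl

theorem interp_lineMap {X Y : ℕ → ℝ} {M : ℕ} (hX : ∀ i < M, X i < X (i + 1)) {i : ℕ} (hi : i < M)
    {τ : ℝ} (h₀ : 0 ≤ τ) (h₁ : τ ≤ 1) :
    interp X Y M ((1 - τ) * X i + τ * X (i + 1)) = (1 - τ) * Y i + τ * Y (i + 1) := by
  have h := sub_pos.2 (hX i hi)
  rw [interp_eq hX hi (by nlinarith) (by nlinarith)]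
  have : (1 - τ) * X i + τ * X (i + 1) - X i = τ * (X (i + 1) - X i) := by ring
  rw [this]
  field_simp
  ring

theorem exists_piece {X : ℕ → ℝ} {M : ℕ} (hM : 0 < M) {x : ℝ} (h₁ : X 0 ≤ x) (h₂ : x ≤ X M) :
    ∃ i < M, X i ≤ x ∧ x ≤ X (i + 1) := by
  induction M with
  | zero => omega
  | succ M ih =>
    by_cases h : X M ≤ x
    · exact ⟨M, Nat.lt_succ_self M, h, h₂⟩
    · have hM : 0 < M := Nat.pos_of_ne_zero fun h0 => h (h0 ▸ h₁)
      obtain ⟨i, hi, h⟩ := ih hM (not_le.1 h).le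
      exact ⟨i, hi.trans (Nat.lt_succ_self M), h⟩

theorem exists_piece_lineMap {X : ℕ → ℝ} {M : ℕ} (hX : ∀ i < M, X i < X (i + 1)) (hM : 0 < M)
    {x : ℝ} (h₁ : X 0 ≤ x) (h₂ : x ≤ X M) :
    ∃ i < M, ∃ τ : ℝ, 0 ≤ τ ∧ τ ≤ 1 ∧ x = (1 - τ) * X i + τ * X (i + 1) := by
  obtain ⟨i, hi, h₁, h₂⟩ := exists_piece hM h₁ h₂
  have h := sub_pos.2 (hX i hi)
  refine ⟨i, hi, (x - X i) / (X (i + 1) - X i), div_nonneg (sub_nonneg.2 h₁) h.le,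
    (div_le_one h).2 (by linarith), ?_⟩
  field_simp
  ring

theorem affine_le_interp {X Y : ℕ → ℝ} {M : ℕ} (hX : ∀ i < M, X i < X (i + 1)) (hM : 0 < M)
    {c d : ℝ} (h : ∀ i ≤ M, c * X i + d ≤ Y i) {x : ℝ} (h₁ : X 0 ≤ x) (h₂ : x ≤ X M) :
    c * x + d ≤ interp X Y M x := by
  obtain ⟨i, hi, τ, h0, h1, rfl⟩ := exists_piece_lineMap hX hM h₁ h₂
  rw [interp_lineMap hX hi h0 h1]
  nlinarith [mul_le_mul_of_nonneg_left (h i hi.le) (sub_nonneg.2 h1),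
    mul_le_mul_of_nonneg_left (h (i + 1) hi) h0]

/-- Equality is allowed at the two end nodes, where the two walls meet. Since `2 ≤ M`, every piece
has an interior node as one of its ends, and this makes the convex combination strict. -/
theorem affine_lt_interp {X Y : ℕ → ℝ} {M : ℕ} (hX : ∀ i < M, X i < X (i + 1)) (hM : 2 ≤ M)
    {c d : ℝ} (h : ∀ i ≤ M, c * X i + d ≤ Y i) (h' : ∀ i, 0 < i → i < M → c * X i + d < Y i)
    {x : ℝ} (h₁ : X 0 < x) (h₂ : x < X M) : c * x + d < interp X Y M x := by
  obtain ⟨i, hi, τ, h0, h1, rfl⟩ := exists_piece_lineMap hX (by omega) h₁.le h₂.le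
  rw [interp_lineMap hX hi h0 h1]
  have e₁ := mul_le_mul_of_nonneg_left (h i hi.le) (sub_nonneg.2 h1)
  have e₂ := mul_le_mul_of_nonneg_left (h (i + 1) hi) h0
  rcases h0.eq_or_lt with rfl | h0
  · have : 0 < i := Nat.pos_of_ne_zero fun h0 => by simp [h0] at h₁
    linarith [h' i this hi]
  rcases h1.eq_or_lt with rfl | h1
  · have : i + 1 ≠ M := fun h0 => by simp [h0] at h₂
    linarith [h' (i + 1) (by omega) (by omega)]
  rcases Nat.eq_zero_or_pos i with h0i | hi0
  · nlinarith [mul_lt_mul_of_pos_left (h' (i + 1) (by omega) (by omega)) h0]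
  · nlinarith [mul_lt_mul_of_pos_left (h' i hi0 hi) (sub_pos.2 h1)]

/-- On a single piece, an affine function that is below `interp` at two points is below it in
between. -/
theorem affine_le_interp_of_piece {X Y : ℕ → ℝ} {M : ℕ} (hX : ∀ i < M, X i < X (i + 1)) {i : ℕ}
    (hi : i < M) {c d x₁ x₂ x : ℝ} (h₁ : X i ≤ x₁) (h₂ : x₂ ≤ X (i + 1))
    (hx₁ : x₁ ≤ x) (hx₂ : x ≤ x₂) (e₁ : c * x₁ + d ≤ interp X Y M x₁)
    (e₂ : c * x₂ + d ≤ interp X Y M x₂) : c * x + d ≤ interp X Y M x := by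
  rw [interp_eq hX hi (by linarith) (by linarith)] at e₁ e₂ ⊢
  generalize (Y (i + 1) - Y i) / (X (i + 1) - X i) = σ at *
  rcases le_total c σ with h | h <;> nlinarith

/-- The segment between two consecutive nodes is the graph of `interp` over that piece. -/
theorem affineSegment_eq_graph {X Y : ℕ → ℝ} {M : ℕ} (hX : ∀ i < M, X i < X (i + 1)) {i : ℕ}
    (hi : i < M) : affineSegment ℝ (X i, Y i) (X (i + 1), Y (i + 1)) =
      {p : ℝ × ℝ | X i ≤ p.1 ∧ p.1 ≤ X (i + 1) ∧ p.2 = interp X Y M p.1} := by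
  have h := sub_pos.2 (hX i hi)
  ext ⟨x, y⟩
  simp only [affineSegment, mem_image, mem_ofPred_eq, mem_Icc, AffineMap.lineMap_apply_module,
    Prod.smul_mk, Prod.mk_add_mk, smul_eq_mul, Prod.mk.injEq]
  constructor
  · rintro ⟨τ, ⟨h0, h1⟩, rfl, rfl⟩
    exact ⟨by nlinarith, by nlinarith, (interp_lineMap hX hi h0 h1).symm⟩
  · rintro ⟨h₁, h₂, rfl⟩
    have e : x = (1 - (x - X i) / (X (i + 1) - X i)) * X i +
        (x - X i) / (X (i + 1) - X i) * X (i + 1) := by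
      field_simp
      ring
    have h0 : 0 ≤ (x - X i) / (X (i + 1) - X i) := div_nonneg (sub_nonneg.2 h₁) h.le
    have h1 : (x - X i) / (X (i + 1) - X i) ≤ 1 := (div_le_one h).2 (by linarith)
    refine ⟨_, ⟨h0, h1⟩, e.symm, ?_⟩
    rw [← interp_lineMap hX hi h0 h1, ← e]

/-! ### The region between two graphs -/

/-- The set between the graphs of `L` and `U` over `[x₀, x₁]`. -/
def between (L U : ℝ → ℝ) (x₀ x₁ : ℝ) : Set (ℝ × ℝ) :=
  {p | x₀ ≤ p.1 ∧ p.1 ≤ x₁ ∧ L p.1 ≤ p.2 ∧ p.2 ≤ U p.1}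

section between

variable {L U : ℝ → ℝ} {x₀ x₁ : ℝ}

theorem isClosed_between (hL : Continuous L) (hU : Continuous U) :
    IsClosed (between L U x₀ x₁) :=
  (isClosed_le continuous_const continuous_fst).inter <|
    (isClosed_le continuous_fst continuous_const).inter <|
      (isClosed_le (by fun_prop) continuous_snd).inter (isClosed_le continuous_snd (by fun_prop))

theorem isCompact_between (hL : Continuous L) (hU : Continuous U) :
    IsCompact (between L U x₀ x₁) := by
  obtain ⟨l, hl⟩ := (isCompact_Icc (a := x₀) (b := x₁)).bddBelow_image hL.continuousOn
  obtain ⟨u, hu⟩ := (isCompact_Icc (a := x₀) (b := x₁)).bddAbove_image hU.continuousOn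
  have hbox := (isCompact_Icc (a := x₀) (b := x₁)).prod (isCompact_Icc (a := l) (b := u))
  refine hbox.of_isClosed_subset (isClosed_between hL hU) ?_
  rintro ⟨x, y⟩ ⟨h₁, h₂, h₃, h₄⟩
  exact ⟨⟨h₁, h₂⟩, (hl (mem_image_of_mem L ⟨h₁, h₂⟩)).trans h₃,
    h₄.trans (hu (mem_image_of_mem U ⟨h₁, h₂⟩))⟩

theorem interior_between (hL : Continuous L) (hU : Continuous U) :
    interior (between L U x₀ x₁) =
      {p | x₀ < p.1 ∧ p.1 < x₁ ∧ L p.1 < p.2 ∧ p.2 < U p.1} := by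
  apply Subset.antisymm
  · intro p hp
    have hp' := interior_subset hp
    -- An interior point can be moved a little in any direction; the four axis directions give the
    -- four strict inequalities.
    have key : ∀ v : ℝ × ℝ, ∃ ε : ℝ, 0 < ε ∧ p + ε • v ∈ between L U x₀ x₁ := by
      intro v
      have hc : ContinuousAt (fun ε : ℝ => p + ε • v) 0 := by fun_prop
      have hn : between L U x₀ x₁ ∈ 𝓝 (p + (0 : ℝ) • v) := by
        simpa using mem_interior_iff_mem_nhds.1 hp
      have := (hc.eventually hn).filter_mono (nhdsWithin_le_nhds (s := Ioi 0))
      obtain ⟨ε, h, hε⟩ := (this.and self_mem_nhdsWithin).exists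
      exact ⟨ε, hε, h⟩
    refine ⟨?_, ?_, ?_, ?_⟩
    · obtain ⟨ε, hε, h, -⟩ := key (-1, 0)
      simp at h
      linarith
    · obtain ⟨ε, hε, -, h, -⟩ := key (1, 0)
      simp at h
      linarith
    · obtain ⟨ε, hε, -, -, h, -⟩ := key (0, -1)
      simp at h
      linarith
    · obtain ⟨ε, hε, -, -, -, h⟩ := key (0, 1)
      simp at h
      linarith
  · refine interior_maximal ?_ ?_
    · rintro p ⟨h₁, h₂, h₃, h₄⟩
      exact ⟨h₁.le, h₂.le, h₃.le, h₄.le⟩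
    · exact (isOpen_lt continuous_const continuous_fst).inter <|
        (isOpen_lt continuous_fst continuous_const).inter <|
          (isOpen_lt (by fun_prop) continuous_snd).inter (isOpen_lt continuous_snd (by fun_prop))

theorem closure_interior_between (hL : Continuous L) (hU : Continuous U) (hx : x₀ < x₁)
    (h₀ : L x₀ = U x₀) (h₁ : L x₁ = U x₁) (h : ∀ x, x₀ < x → x < x₁ → L x < U x) :
    closure (interior (between L U x₀ x₁)) = between L U x₀ x₁ := by
  apply Subset.antisymm
  · exact (isClosed_between hL hU).closure_subset_iff.2 interior_subset
  rw [interior_between hL hU]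
  -- The midline is a curve in the closure that reaches the points where the graphs touch, in
  -- particular both ends.
  have mid : ∀ x, x₀ ≤ x → x ≤ x₁ → ((x, (L x + U x) / 2) : ℝ × ℝ) ∈
      closure {p : ℝ × ℝ | x₀ < p.1 ∧ p.1 < x₁ ∧ L p.1 < p.2 ∧ p.2 < U p.1} := by
    intro x h₁ h₂
    have hx' : x ∈ closure (Ioo x₀ x₁) := by
      rw [closure_Ioo hx.ne]
      exact ⟨h₁, h₂⟩
    refine map_mem_closure (f := fun x => ((x, (L x + U x) / 2) : ℝ × ℝ)) (by fun_prop) hx' ?_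
    intro x hx
    have := h x hx.1 hx.2
    exact ⟨hx.1, hx.2, by simp only; linarith, by simp only; linarith⟩
  rintro ⟨x, y⟩ ⟨h₂, h₃, h₄, h₅⟩
  simp only at h₂ h₃ h₄ h₅
  by_cases e : L x = U x
  · have : y = (L x + U x) / 2 := by linarith
    rw [this]
    exact mid x h₂ h₃
  have hx₀ : x₀ < x := lt_of_le_of_ne h₂ (by rintro rfl; exact e h₀)
  have hx₁ : x < x₁ := lt_of_le_of_ne h₃ (by rintro rfl; exact e h₁)
  have hy : y ∈ closure (Ioo (L x) (U x)) := by
    rw [closure_Ioo e]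
    exact ⟨h₄, h₅⟩
  refine map_mem_closure (f := fun y => ((x, y) : ℝ × ℝ)) (by fun_prop) hy ?_
  intro y hy
  exact ⟨hx₀, hx₁, hy.1, hy.2⟩

/-- The graphs meet at both ends, so the vertical sides degenerate to points and contribute nothing
beyond the graphs. -/
theorem frontier_between (hL : Continuous L) (hU : Continuous U)
    (h₀ : L x₀ = U x₀) (h₁ : L x₁ = U x₁) (h : ∀ x, x₀ ≤ x → x ≤ x₁ → L x ≤ U x) :
    frontier (between L U x₀ x₁) =
      {p | x₀ ≤ p.1 ∧ p.1 ≤ x₁ ∧ (p.2 = L p.1 ∨ p.2 = U p.1)} := by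
  rw [(isClosed_between hL hU).frontier_eq, interior_between hL hU]
  ext ⟨x, y⟩
  simp only [between, mem_sdiff, mem_ofPred_eq, not_and, not_lt]
  constructor
  · rintro ⟨⟨h₂, h₃, h₄, h₅⟩, h₆⟩
    refine ⟨h₂, h₃, ?_⟩
    rcases h₂.eq_or_lt with rfl | h₂
    · exact Or.inl (by linarith)
    rcases h₃.eq_or_lt with rfl | h₃
    · exact Or.inl (by linarith)
    rcases h₄.eq_or_lt with h₄ | h₄
    · exact Or.inl h₄.symm
    · exact Or.inr (h₅.antisymm (h₆ h₂ h₃ h₄))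
  · rintro ⟨h₂, h₃, rfl | rfl⟩
    · exact ⟨⟨h₂, h₃, le_rfl, h x h₂ h₃⟩, fun _ _ h => absurd h (lt_irrefl _)⟩
    · exact ⟨⟨h₂, h₃, h x h₂ h₃, le_rfl⟩, fun _ _ _ => le_rfl⟩

end between

/-! ### Polygons bounded by two monotone chains -/

theorem finRotate_val {N : ℕ} (i : Fin N) :
    ((finRotate N i : Fin N) : ℕ) = if (i : ℕ) + 1 = N then 0 else (i : ℕ) + 1 := by
  cases N with
  | zero => exact i.elim0
  | succ N =>
    rw [coe_finRotate]
    simp [Fin.ext_iff]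

/-- The `i`-th vertex of the polygon formed by the lower chain `(X j, Y j)`, `j ≤ p`, and the upper
chain `(X' j, Y' j)`, `j ≤ q`, traversed backwards. -/
def chainVertex (X Y X' Y' : ℕ → ℝ) (p q i : ℕ) : ℝ × ℝ :=
  if i ≤ p then (X i, Y i) else (X' (p + q - i), Y' (p + q - i))

/-- The polygon bounded by a lower and an upper chain. -/
def chainPolygon (X Y X' Y' : ℕ → ℝ) (p q : ℕ) : Polygon (ℝ × ℝ) (p + q) :=
  ⟨fun i => chainVertex X Y X' Y' p q i⟩

/-- A lower chain with `p` edges and an upper chain with `q` edges, both `x`-monotone, that have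
their end points in common and do not meet elsewhere. -/
structure IsChainPair (X Y X' Y' : ℕ → ℝ) (p q : ℕ) : Prop where
  pos : 0 < p
  two_le : 2 ≤ q
  lower_lt : ∀ i < p, X i < X (i + 1)
  upper_lt : ∀ i < q, X' i < X' (i + 1)
  left : X' 0 = X 0 ∧ Y' 0 = Y 0
  right : X' q = X p ∧ Y' q = Y p
  lt : ∀ x, X 0 < x → x < X p → interp X Y p x < interp X' Y' q x

namespace IsChainPair

variable {X Y X' Y' : ℕ → ℝ} {p q : ℕ} (H : IsChainPair X Y X' Y' p q)

include H

theorem left_eq : interp X Y p (X 0) = interp X' Y' q (X 0) := by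
  rw [interp_node H.lower_lt (Nat.zero_le _), ← H.left.1, interp_node H.upper_lt (Nat.zero_le _),
    H.left.2]

theorem right_eq : interp X Y p (X p) = interp X' Y' q (X p) := by
  rw [interp_node H.lower_lt le_rfl, ← H.right.1, interp_node H.upper_lt le_rfl, H.right.2]

theorem le {x : ℝ} (h₀ : X 0 ≤ x) (h₁ : x ≤ X p) : interp X Y p x ≤ interp X' Y' q x := by
  rcases h₀.eq_or_lt with rfl | h₀
  · exact H.left_eq.le
  rcases h₁.eq_or_lt with rfl | h₁
  · exact H.right_eq.le
  exact (H.lt x h₀ h₁).le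

/-- The vertex `i = p` belongs to both chains, and `i = p + q` closes up to vertex `0`; the formula
thus treats all upper edges alike, including the last one. -/
theorem chainVertex_upper {i : ℕ} (hi : p ≤ i) :
    chainVertex X Y X' Y' p q i = (X' (p + q - i), Y' (p + q - i)) := by
  unfold chainVertex
  split_ifs with h
  · obtain rfl : i = p := le_antisymm h hi
    simp [H.right]
  · rfl

theorem chainPolygon_finRotate (i : Fin (p + q)) :
    chainPolygon X Y X' Y' p q (finRotate (p + q) i) = chainVertex X Y X' Y' p q (i + 1) := by
  simp only [chainPolygon, finRotate_val]
  split_ifs with h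
  · rw [h, H.chainVertex_upper (i := p + q) (by omega)]
    simp [chainVertex, H.left]
  · rfl

theorem edgeSet_lower {i : Fin (p + q)} (hi : (i : ℕ) < p) :
    (chainPolygon X Y X' Y' p q).edgeSet ℝ i =
      {x : ℝ × ℝ | X i ≤ x.1 ∧ x.1 ≤ X (i + 1) ∧ x.2 = interp X Y p x.1} := by
  rw [Polygon.edgeSet, H.chainPolygon_finRotate, ← affineSegment_eq_graph H.lower_lt hi]
  simp only [chainPolygon, chainVertex, hi.le, Nat.succ_le_of_lt hi, if_true]

theorem edgeSet_upper {i : Fin (p + q)} {j : ℕ} (hi : p ≤ (i : ℕ)) (hj : (i : ℕ) + j + 1 = p + q) :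
    (chainPolygon X Y X' Y' p q).edgeSet ℝ i =
      {x : ℝ × ℝ | X' j ≤ x.1 ∧ x.1 ≤ X' (j + 1) ∧ x.2 = interp X' Y' q x.1} := by
  rw [Polygon.edgeSet, H.chainPolygon_finRotate, ← affineSegment_eq_graph H.upper_lt (by omega),
    affineSegment_comm]
  simp only [chainPolygon]
  rw [H.chainVertex_upper hi, H.chainVertex_upper (by omega),
    show p + q - (i + 1 : ℕ) = j by omega, show p + q - (i : ℕ) = j + 1 by omega]

theorem boundary_eq : (chainPolygon X Y X' Y' p q).boundary ℝ =
    {x : ℝ × ℝ | X 0 ≤ x.1 ∧ x.1 ≤ X p ∧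
      (x.2 = interp X Y p x.1 ∨ x.2 = interp X' Y' q x.1)} := by
  have m₁ := (strictMonoOn_of_step H.lower_lt).monotoneOn
  have m₂ := (strictMonoOn_of_step H.upper_lt).monotoneOn
  ext x
  simp only [Polygon.boundary, mem_iUnion, mem_ofPred_eq]
  constructor
  · rintro ⟨i, hi⟩
    rcases lt_or_ge (i : ℕ) p with h | h
    · rw [H.edgeSet_lower h] at hi
      exact ⟨(m₁ (mem_Iic.2 (Nat.zero_le _)) (mem_Iic.2 h.le) (Nat.zero_le _)).trans hi.1,
        hi.2.1.trans (m₁ (mem_Iic.2 h) (mem_Iic.2 le_rfl) h), Or.inl hi.2.2⟩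
    · have hj : (i : ℕ) + (p + q - i - 1) + 1 = p + q := by omega
      rw [H.edgeSet_upper h hj] at hi
      rw [← H.left.1, ← H.right.1]
      have hq : p + q - (i : ℕ) - 1 + 1 ≤ q := by omega
      exact ⟨(m₂ (mem_Iic.2 (Nat.zero_le _)) (mem_Iic.2 (by omega)) (Nat.zero_le _)).trans hi.1,
        hi.2.1.trans (m₂ (mem_Iic.2 hq) (mem_Iic.2 le_rfl) hq), Or.inr hi.2.2⟩
  · rintro ⟨h₁, h₂, h | h⟩
    · obtain ⟨i, hi, h₁, h₂⟩ := exists_piece H.pos h₁ h₂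
      refine ⟨⟨i, by omega⟩, ?_⟩
      rw [H.edgeSet_lower hi]
      exact ⟨h₁, h₂, h⟩
    · rw [← H.left.1] at h₁
      rw [← H.right.1] at h₂
      obtain ⟨i, hi, h₁, h₂⟩ := exists_piece (by have := H.two_le; omega) h₁ h₂
      refine ⟨⟨p + q - i - 1, by omega⟩, ?_⟩
      rw [H.edgeSet_upper (j := i) (by simp only; omega) (by simp only; omega)]
      exact ⟨h₁, h₂, h⟩

theorem isRegion : IsRegion (chainPolygon X Y X' Y' p q)
    (between (interp X Y p) (interp X' Y' q) (X 0) (X p)) := by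
  have hL := continuous_interp X Y p
  have hU := continuous_interp X' Y' q
  refine ⟨isCompact_between hL hU, closure_interior_between hL hU ?_ H.left_eq H.right_eq H.lt, ?_⟩
  · exact strictMonoOn_of_step H.lower_lt (mem_Iic.2 (Nat.zero_le _)) (mem_Iic.2 le_rfl) H.pos
  · rw [frontier_between hL hU H.left_eq H.right_eq fun x => H.le, H.boundary_eq]

/-- Within one chain the abscissae of non-adjacent edges are disjoint. Edges of different chains can
meet only over the two common end points, because the chains are strictly apart in between. -/
theorem edgeSet_inter {i j : Fin (p + q)} (hij : i < j) {x : ℝ × ℝ}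
    (hi : x ∈ (chainPolygon X Y X' Y' p q).edgeSet ℝ i)
    (hj : x ∈ (chainPolygon X Y X' Y' p q).edgeSet ℝ j) :
    ((j : ℕ) = i + 1 ∧ x = chainVertex X Y X' Y' p q j) ∨
      ((i : ℕ) = 0 ∧ (j : ℕ) + 1 = p + q ∧ x = chainVertex X Y X' Y' p q 0) := by
  have m₁ := strictMonoOn_of_step H.lower_lt
  have m₂ := strictMonoOn_of_step H.upper_lt
  have hij' : (i : ℕ) < j := hij
  rcases lt_or_ge (j : ℕ) p with h | h
  · rw [H.edgeSet_lower (hij'.trans h)] at hi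
    rw [H.edgeSet_lower h] at hj
    have hle := (m₁.le_iff_le (mem_Iic.2 h.le) (mem_Iic.2 (by omega))).1 (hj.1.trans hi.2.1)
    have e : (j : ℕ) = i + 1 := by omega
    have ex : x.1 = X j := le_antisymm (e ▸ hi.2.1) hj.1
    refine Or.inl ⟨e, Prod.ext ?_ ?_⟩
    · simp [chainVertex, h.le, ex]
    · rw [hj.2.2, ex, interp_node H.lower_lt h.le]
      simp [chainVertex, h.le]
  obtain ⟨j', hj'⟩ : ∃ j', (j : ℕ) + j' + 1 = p + q := ⟨p + q - j - 1, by omega⟩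
  rw [H.edgeSet_upper h hj'] at hj
  rcases lt_or_ge (i : ℕ) p with h' | h'
  · rw [H.edgeSet_lower h'] at hi
    have b₁ : X 0 ≤ x.1 :=
      (m₁.monotoneOn (mem_Iic.2 (Nat.zero_le _)) (mem_Iic.2 h'.le) (Nat.zero_le _)).trans hi.1
    have b₂ : x.1 ≤ X p := hi.2.1.trans (m₁.monotoneOn (mem_Iic.2 h') (mem_Iic.2 le_rfl) h')
    rcases b₁.eq_or_lt with b₁ | b₁
    · have e₁ := (m₁.le_iff_le (mem_Iic.2 h'.le) (mem_Iic.2 (Nat.zero_le _))).1 (b₁ ▸ hi.1)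
      have e₂ := (m₂.le_iff_le (mem_Iic.2 (by omega)) (mem_Iic.2 (Nat.zero_le _))).1
        (hj.1.trans (b₁.symm.trans H.left.1.symm).le)
      refine Or.inr ⟨by omega, by omega, Prod.ext ?_ ?_⟩
      · simp [chainVertex, b₁]
      · rw [hi.2.2, ← b₁, interp_node H.lower_lt (Nat.zero_le _)]
        simp [chainVertex]
    rcases b₂.eq_or_lt with b₂ | b₂
    · have e₁ := (m₁.le_iff_le (mem_Iic.2 le_rfl) (mem_Iic.2 h')).1 (b₂ ▸ hi.2.1)
      have e₂ := (m₂.le_iff_le (mem_Iic.2 le_rfl) (mem_Iic.2 (by omega))).1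
        ((H.right.1.trans b₂.symm).le.trans hj.2.1)
      have ej : (j : ℕ) = p := by omega
      refine Or.inl ⟨by omega, Prod.ext ?_ ?_⟩
      · simp [chainVertex, b₂, ej]
      · rw [hi.2.2, b₂, interp_node H.lower_lt le_rfl]
        simp [chainVertex, ej]
    · exact absurd (hi.2.2.symm.trans hj.2.2) (H.lt x.1 b₁ b₂).ne
  · obtain ⟨i', hi'⟩ : ∃ i', (i : ℕ) + i' + 1 = p + q := ⟨p + q - i - 1, by omega⟩
    rw [H.edgeSet_upper h' hi'] at hi
    have hle := (m₂.le_iff_le (mem_Iic.2 (by omega)) (mem_Iic.2 (by omega))).1 (hi.1.trans hj.2.1)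
    have e : i' = j' + 1 := by omega
    have ex : x.1 = X' i' := le_antisymm (e ▸ hj.2.1) hi.1
    refine Or.inl ⟨by omega, ?_⟩
    rw [H.chainVertex_upper h, show p + q - (j : ℕ) = i' by omega]
    refine Prod.ext ex ?_
    rw [hi.2.2, ex, interp_node H.upper_lt (by omega)]

theorem isSimple : IsSimple (chainPolygon X Y X' Y' p q) := by
  have hpos := H.pos
  have htwo := H.two_le
  refine ⟨by omega, ?_, ?_⟩
  · intro i hi
    rw [H.chainPolygon_finRotate] at hi
    simp only [chainPolygon] at hi
    rcases lt_or_ge (i : ℕ) p with h | h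
    · simp only [chainVertex, h.le, Nat.succ_le_of_lt h, if_true, Prod.mk.injEq] at hi
      exact (H.lower_lt i h).ne hi.1
    · rw [H.chainVertex_upper h, H.chainVertex_upper (by omega), Prod.mk.injEq] at hi
      have := H.upper_lt (p + q - i - 1) (by omega)
      rw [show p + q - (i : ℕ) - 1 + 1 = p + q - i by omega,
        show p + q - (i : ℕ) - 1 = p + q - (i + 1) by omega] at this
      exact this.ne hi.1.symm
  · have key : ∀ i j : Fin (p + q), i < j → ∀ x ∈ (chainPolygon X Y X' Y' p q).edgeSet ℝ i ∩
        (chainPolygon X Y X' Y' p q).edgeSet ℝ j,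
        (j = finRotate _ i ∧ x = chainPolygon X Y X' Y' p q j) ∨
          (i = finRotate _ j ∧ x = chainPolygon X Y X' Y' p q i) := by
      rintro i j hij x ⟨hi, hj⟩
      rcases H.edgeSet_inter hij hi hj with ⟨h₁, h₂⟩ | ⟨h₁, h₂, h₃⟩
      · refine Or.inl ⟨Fin.ext ?_, h₂⟩
        rw [finRotate_val, if_neg (by omega), h₁]
      · refine Or.inr ⟨Fin.ext ?_, ?_⟩
        · rw [finRotate_val, if_pos h₂, h₁]
        · simpa [chainPolygon, h₁] using h₃
    intro i j hij x hx
    rcases lt_or_gt_of_ne hij with h | h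
    · exact key i j h x hx
    · exact (key j i h x hx.symm).symm

end IsChainPair

/-! ### Tangents, gates and the vertices of the walls -/

/-- The lines `y = tangent r i x` are tangent to the parabola `2 r y = x ^ 2` at `x = 2 r i`. -/
def tangent (r i x : ℝ) : ℝ := 2 * i * x - 2 * r * i ^ 2

theorem tangent_eq (r i x : ℝ) : tangent r i x = (2 * i) * x + -(2 * r * i ^ 2) := by
  unfold tangent
  ring

/-- The horizontal distance from the `i`-th tangent point to the `i`-th gate. -/
def gateWidth (r m i : ℕ) : ℝ := if i < m then 2 * r - 1 else 1

/-- The `i`-th gate, on the chord between the tangent points `i` and `i + 1`. -/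
def gate (r m i : ℕ) : ℝ × ℝ :=
  (2 * r * i + gateWidth r m i, 2 * r * (i : ℝ) ^ 2 + (2 * i + 1) * gateWidth r m i)

/-- The intersection of the tangents `i` and `i + 1`. -/
def valley (r i : ℕ) : ℝ × ℝ := (2 * r * i + r, 2 * r * ((i : ℝ) ^ 2 + i))

/-- The right end of the corridor. -/
def target (r m : ℕ) : ℝ × ℝ := (4 * r * m + 1, 8 * r * (m : ℝ) ^ 2 + 4 * m)

/-- The vertices of the lower wall: `e + 1` points on the `x`-axis, the valleys, the target. -/
def lower (r m e j : ℕ) : ℝ × ℝ :=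
  if j ≤ e then (1 + j, 0) else if j ≤ e + 2 * m then valley r (j - e - 1) else target r m

/-- The vertices of the upper wall: the start, the gates, the target. -/
def upper (r m j : ℕ) : ℝ × ℝ :=
  if j = 0 then (1, 0) else if j ≤ 2 * m then gate r m (j - 1) else target r m

theorem lower_flat {r m e j : ℕ} (h : j ≤ e) : lower r m e j = (1 + (j : ℝ), 0) := if_pos h

theorem lower_valley {r m e j : ℕ} (h : j < 2 * m) : lower r m e (e + 1 + j) = valley r j := by
  rw [lower, if_neg (by omega), if_pos (by omega), show e + 1 + j - e - 1 = j by omega]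

theorem lower_target {r m e : ℕ} : lower r m e (e + 1 + 2 * m) = target r m := by
  rw [lower, if_neg (by omega), if_neg (by omega)]

theorem upper_zero {r m : ℕ} : upper r m 0 = (1, 0) := rfl

theorem upper_gate {r m j : ℕ} (h : j < 2 * m) : upper r m (j + 1) = gate r m j := by
  rw [upper, if_neg (by omega), if_pos (by omega), Nat.add_sub_cancel]

theorem upper_target {r m : ℕ} : upper r m (2 * m + 1) = target r m := by
  rw [upper, if_neg (by omega), if_neg (by omega)]

theorem lower_cases (r m e j : ℕ) (h : j ≤ e + 1 + 2 * m) :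
    (j ≤ e ∧ lower r m e j = (1 + (j : ℝ), 0)) ∨
      (∃ d < 2 * m, j = e + 1 + d ∧ lower r m e j = valley r d) ∨
      (j = e + 1 + 2 * m ∧ lower r m e j = target r m) := by
  rcases le_or_gt j e with h' | h'
  · exact Or.inl ⟨h', lower_flat h'⟩
  obtain ⟨d, rfl⟩ : ∃ d, j = e + 1 + d := ⟨j - e - 1, by omega⟩
  rcases lt_or_ge d (2 * m) with hd | hd
  · exact Or.inr (Or.inl ⟨d, hd, rfl, lower_valley hd⟩)
  · obtain rfl : d = 2 * m := by omega
    exact Or.inr (Or.inr ⟨rfl, lower_target⟩)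

theorem upper_cases (r m j : ℕ) (h : j ≤ 2 * m + 1) :
    (j = 0 ∧ upper r m j = (1, 0)) ∨ (∃ d < 2 * m, j = d + 1 ∧ upper r m j = gate r m d) ∨
      (j = 2 * m + 1 ∧ upper r m j = target r m) := by
  rcases j with - | d
  · exact Or.inl ⟨rfl, upper_zero⟩
  rcases lt_or_ge d (2 * m) with hd | hd
  · exact Or.inr (Or.inl ⟨d, hd, rfl, upper_gate hd⟩)
  · obtain rfl : d = 2 * m := by omega
    exact Or.inr (Or.inr ⟨rfl, upper_target⟩)

theorem gateWidth_mem {r m i : ℕ} (hr : 5 ≤ r) :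
    1 ≤ gateWidth r m i ∧ gateWidth r m i ≤ 2 * r - 1 := by
  have : (5 : ℝ) ≤ r := by exact_mod_cast hr
  unfold gateWidth
  split_ifs <;> constructor <;> linarith

/-- The product of two consecutive integers is nonnegative; this is where integrality of the tangent
indices enters. -/
theorem sq_add_self_nonneg (i j : ℕ) : 0 ≤ ((j : ℝ) - i) ^ 2 + (j - i) := by
  rcases le_or_gt i j with h | h
  · have : (i : ℝ) ≤ j := by exact_mod_cast h
    nlinarith
  · have : (j : ℝ) + 1 ≤ i := by exact_mod_cast h
    nlinarith

theorem tangent_le_valley (r i j : ℕ) : tangent r i (valley r j).1 ≤ (valley r j).2 := by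
  have h := mul_nonneg (Nat.cast_nonneg (α := ℝ) r) (sq_add_self_nonneg i j)
  simp only [tangent, valley]
  nlinarith

theorem tangent_le_target {r : ℕ} (hr : 5 ≤ r) (m i : ℕ) :
    tangent r i (target r m).1 ≤ (target r m).2 := by
  have h := sq_add_self_nonneg i (2 * m)
  have hr : (5 : ℝ) ≤ r := by exact_mod_cast hr
  have h' := mul_nonneg (sub_nonneg.2 hr) (sq_nonneg ((2 : ℝ) * m - i))
  simp only [tangent, target]
  push_cast at h
  nlinarith [sq_nonneg ((2 : ℝ) * m - i)]

theorem tangent_le_axis {r i : ℕ} {x : ℝ} (h : x ≤ r) : tangent r i x ≤ 0 := by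
  have h' := sq_add_self_nonneg i 0
  have hi := mul_nonneg (Nat.cast_nonneg (α := ℝ) i) (sub_nonneg.2 h)
  have := mul_nonneg (Nat.cast_nonneg (α := ℝ) r) h'
  simp only [tangent]
  push_cast at this
  nlinarith

/-- A gate is an interior point of a chord, so it is strictly above the parabola, which is above all
its tangents. -/
theorem tangent_lt_gate {r m : ℕ} (hr : 5 ≤ r) (i j : ℕ) :
    tangent r i (gate r m j).1 < (gate r m j).2 := by
  obtain ⟨h₁, h₂⟩ := gateWidth_mem (m := m) (i := j) hr
  have hr : (5 : ℝ) ≤ r := by exact_mod_cast hr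
  simp only [tangent, gate]
  generalize gateWidth r m j = a at *
  suffices 0 < 2 * r * ((j : ℝ) - i) ^ 2 + a * (2 * (j - i) + 1) by nlinarith
  rcases le_or_gt i j with h | h
  · have : 0 ≤ (j : ℝ) - i := sub_nonneg.2 (by exact_mod_cast h)
    positivity
  · have : (j : ℝ) - i + 1 ≤ 0 := by
      have : (j : ℝ) + 1 ≤ i := by exact_mod_cast h
      linarith
    nlinarith [mul_nonneg (by linarith : (0 : ℝ) ≤ r) (sq_nonneg ((j : ℝ) - i + 1))]

/-! ### The corridor polygon -/

section corridor

variable {r m e : ℕ}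

theorem lower_lt (hr : 5 ≤ r) (he : e + 1 < r) (hm : 0 < m) :
    ∀ j < e + 1 + 2 * m, (lower r m e j).1 < (lower r m e (j + 1)).1 := by
  have hr' : (5 : ℝ) ≤ r := by exact_mod_cast hr
  have he' : (e : ℝ) + 1 < r := by exact_mod_cast he
  intro j hj
  rcases lower_cases r m e j hj.le with ⟨h, e₁⟩ | ⟨d, hd, rfl, e₁⟩ | ⟨h, e₁⟩
  · rw [e₁]
    rcases lower_cases r m e (j + 1) hj with ⟨h', e₂⟩ | ⟨d, hd, h', e₂⟩ | ⟨h', e₂⟩ <;> rw [e₂]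
    · simp
    · obtain rfl : d = 0 := by omega
      obtain rfl : j = e := by omega
      simp only [valley]
      push_cast
      linarith
    · omega
  · rw [e₁]
    rcases lower_cases r m e (e + 1 + d + 1) hj with ⟨h', e₂⟩ | ⟨d', hd', h', e₂⟩ | ⟨h', e₂⟩ <;>
      rw [e₂]
    · omega
    · obtain rfl : d' = d + 1 := by omega
      simp only [valley]
      push_cast
      linarith
    · have : (d : ℝ) + 1 = 2 * m := by
        have : d + 1 = 2 * m := by omega
        exact_mod_cast this
      simp only [valley, target]
      nlinarith
  · omega

theorem upper_lt (hr : 5 ≤ r) (hm : 0 < m) :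
    ∀ j < 2 * m + 1, (upper r m j).1 < (upper r m (j + 1)).1 := by
  have hr' : (5 : ℝ) ≤ r := by exact_mod_cast hr
  intro j hj
  rcases upper_cases r m j hj.le with ⟨rfl, e₁⟩ | ⟨d, hd, rfl, e₁⟩ | ⟨h, e₁⟩
  · rw [e₁, upper_gate (by omega)]
    simp only [gate, gateWidth, hm, if_true]
    push_cast
    linarith
  · rw [e₁]
    have h₁ := (gateWidth_mem (m := m) (i := d) hr)
    rcases upper_cases r m (d + 1 + 1) hj with ⟨h', e₂⟩ | ⟨d', hd', h', e₂⟩ | ⟨h', e₂⟩ <;>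
      rw [e₂]
    · omega
    · obtain rfl : d' = d + 1 := by omega
      have h₂ := (gateWidth_mem (m := m) (i := d + 1) hr)
      simp only [gate]
      push_cast
      linarith
    · have : (d : ℝ) + 1 = 2 * m := by
        have : d + 1 = 2 * m := by omega
        exact_mod_cast this
      simp only [gate, target]
      nlinarith
  · omega

theorem tangent_le_lower (hr : 5 ≤ r) (he : e + 1 < r) (i j : ℕ) (hj : j ≤ e + 1 + 2 * m) :
    tangent r i (lower r m e j).1 ≤ (lower r m e j).2 := by
  rcases lower_cases r m e j hj with ⟨h, e₁⟩ | ⟨d, hd, rfl, e₁⟩ | ⟨h, e₁⟩ <;> rw [e₁]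
  · refine tangent_le_axis ?_
    have : 1 + j ≤ r := by omega
    simpa using (by exact_mod_cast this : (1 + j : ℝ) ≤ r)
  · exact tangent_le_valley r i d
  · exact tangent_le_target hr m i

theorem tangent_le_upper (hr : 5 ≤ r) (i j : ℕ) (hj : j ≤ 2 * m + 1) :
    tangent r i (upper r m j).1 ≤ (upper r m j).2 := by
  rcases upper_cases r m j hj with ⟨h, e₁⟩ | ⟨d, hd, rfl, e₁⟩ | ⟨h, e₁⟩ <;> rw [e₁]
  · refine tangent_le_axis ?_
    have : 1 ≤ r := by omega
    simpa using this
  · exact (tangent_lt_gate hr i d).le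
  · exact tangent_le_target hr m i

variable (r m e) in
/-- The lower wall as a function. -/
noncomputable def floor : ℝ → ℝ :=
  interp (fun j => (lower r m e j).1) (fun j => (lower r m e j).2) (e + 1 + 2 * m)

variable (r m) in
/-- The upper wall as a function. -/
noncomputable def ceiling : ℝ → ℝ :=
  interp (fun j => (upper r m j).1) (fun j => (upper r m j).2) (2 * m + 1)

/-- Every lower edge lies on one tangent: number `0` up to the first valley, then number `d + 1`
from valley `d` to the next vertex. The target lies on tangent `2 m`. -/
theorem lower_mem_tangent (hm : 0 < m) {j : ℕ} (hj : j < e + 1 + 2 * m) :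
    ∃ i : ℕ, (lower r m e j).2 = tangent r i (lower r m e j).1 ∧
      (lower r m e (j + 1)).2 = tangent r i (lower r m e (j + 1)).1 := by
  rcases lower_cases r m e j hj.le with ⟨h, e₁⟩ | ⟨d, hd, rfl, e₁⟩ | ⟨h, e₁⟩
  · refine ⟨0, ?_, ?_⟩
    · simp [e₁, tangent]
    · rcases lower_cases r m e (j + 1) hj with ⟨h', e₂⟩ | ⟨d, hd, h', e₂⟩ | ⟨h', e₂⟩
      · simp [e₂, tangent]
      · obtain rfl : d = 0 := by omega
        simp [e₂, tangent, valley]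
      · omega
  · refine ⟨d + 1, ?_, ?_⟩
    · rw [e₁]
      simp only [tangent, valley]
      push_cast
      ring
    · rcases lower_cases r m e (e + 1 + d + 1) hj with ⟨h', e₂⟩ | ⟨d', hd', h', e₂⟩ | ⟨h', e₂⟩
      · omega
      · obtain rfl : d' = d + 1 := by omega
        rw [e₂]
        simp only [tangent, valley]
        push_cast
        ring
      · have : ((d + 1 : ℕ) : ℝ) = 2 * m := by
          have : d + 1 = 2 * m := by omega
          exact_mod_cast this
        rw [e₂, this]
        simp only [tangent, target]
        ring
  · omega

theorem lower_zero_fst : (lower r m e 0).1 = 1 := by simp [lower_flat]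

/-- Over the corridor, the floor is the maximum of the tangents. -/
theorem exists_floor_eq_tangent (hr : 5 ≤ r) (he : e + 1 < r) (hm : 0 < m) {x : ℝ} (h₁ : 1 ≤ x)
    (h₂ : x ≤ (target r m).1) : ∃ i : ℕ, floor r m e x = tangent r i x := by
  have hX := lower_lt hr he hm
  rw [← lower_target (e := e)] at h₂
  rw [← lower_zero_fst (r := r) (m := m) (e := e)] at h₁
  obtain ⟨j, hj, τ, h0, h1, rfl⟩ :=
    exists_piece_lineMap (X := fun j => (lower r m e j).1) hX (by omega) h₁ h₂
  obtain ⟨i, e₁, e₂⟩ := lower_mem_tangent (r := r) hm hj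
  refine ⟨i, ?_⟩
  rw [floor, interp_lineMap hX hj h0 h1, e₁, e₂]
  simp only [tangent]
  ring

theorem tangent_le_floor (hr : 5 ≤ r) (he : e + 1 < r) (hm : 0 < m) (i : ℕ) {x : ℝ} (h₁ : 1 ≤ x)
    (h₂ : x ≤ (target r m).1) : tangent r i x ≤ floor r m e x := by
  rw [← lower_target (e := e)] at h₂
  rw [← lower_zero_fst (r := r) (m := m) (e := e)] at h₁
  rw [tangent_eq]
  refine affine_le_interp (X := fun j => (lower r m e j).1) (lower_lt hr he hm) (by omega) ?_ h₁ h₂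
  intro j hj
  rw [← tangent_eq]
  exact tangent_le_lower hr he i j hj

theorem isChainPair (hr : 5 ≤ r) (he : e + 1 < r) (hm : 0 < m) :
    IsChainPair (fun j => (lower r m e j).1) (fun j => (lower r m e j).2)
      (fun j => (upper r m j).1) (fun j => (upper r m j).2) (e + 1 + 2 * m) (2 * m + 1) where
  pos := by omega
  two_le := by omega
  lower_lt := lower_lt hr he hm
  upper_lt := upper_lt hr hm
  left := by simp [lower_flat, upper_zero]
  right := by simp [lower_target, upper_target]
  lt := by
    intro x h₁ h₂
    simp only [lower_zero_fst, lower_target] at h₁ h₂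
    obtain ⟨i, hi⟩ := exists_floor_eq_tangent hr he hm h₁.le h₂.le
    rw [floor] at hi
    rw [hi, tangent_eq]
    refine affine_lt_interp (upper_lt hr hm) (by omega) ?_ ?_ (by rwa [upper_zero])
      (by rwa [upper_target])
    · intro j hj
      rw [← tangent_eq]
      exact tangent_le_upper hr i j hj
    · intro j h0 hj
      rw [← tangent_eq]
      obtain ⟨d, rfl⟩ : ∃ d, j = d + 1 := ⟨j - 1, by omega⟩
      rw [upper_gate (by omega)]
      exact tangent_lt_gate hr i d

variable (r m e) in
/-- The closed region of the corridor. -/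
def corridor : Set (ℝ × ℝ) := between (floor r m e) (ceiling r m) 1 (target r m).1

variable (r m e) in
/-- The polygon bounding the corridor. -/
def corridorPolygon : Polygon (ℝ × ℝ) (e + 1 + 2 * m + (2 * m + 1)) :=
  chainPolygon (fun j => (lower r m e j).1) (fun j => (lower r m e j).2)
    (fun j => (upper r m j).1) (fun j => (upper r m j).2) (e + 1 + 2 * m) (2 * m + 1)

theorem isRegion_corridor (hr : 5 ≤ r) (he : e + 1 < r) (hm : 0 < m) :
    IsRegion (corridorPolygon r m e) (corridor r m e) := by
  have := (isChainPair hr he hm).isRegion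
  simp only [lower_zero_fst, lower_target] at this
  exact this

theorem isSimple_corridorPolygon (hr : 5 ≤ r) (he : e + 1 < r) (hm : 0 < m) :
    IsSimple (corridorPolygon r m e) :=
  (isChainPair hr he hm).isSimple

theorem boundary_corridorPolygon (hr : 5 ≤ r) (he : e + 1 < r) (hm : 0 < m) :
    (corridorPolygon r m e).boundary ℝ = {x : ℝ × ℝ | 1 ≤ x.1 ∧ x.1 ≤ (target r m).1 ∧
      (x.2 = floor r m e x.1 ∨ x.2 = ceiling r m x.1)} := by
  have := (isChainPair hr he hm).boundary_eq
  simp only [lower_zero_fst, lower_target] at this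
  exact this

theorem floor_le_ceiling (hr : 5 ≤ r) (he : e + 1 < r) (hm : 0 < m) {x : ℝ} (h₁ : 1 ≤ x)
    (h₂ : x ≤ (target r m).1) : floor r m e x ≤ ceiling r m x := by
  rw [← lower_target (e := e)] at h₂
  rw [← lower_zero_fst (r := r) (m := m) (e := e)] at h₁
  exact (isChainPair hr he hm).le h₁ h₂

theorem boundary_subset_corridor (hr : 5 ≤ r) (he : e + 1 < r) (hm : 0 < m) :
    (corridorPolygon r m e).boundary ℝ ⊆ corridor r m e := by
  rw [boundary_corridorPolygon hr he hm]
  rintro p ⟨h₁, h₂, h | h⟩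
  · exact ⟨h₁, h₂, h.ge, h.trans_le (floor_le_ceiling hr he hm h₁ h₂)⟩
  · exact ⟨h₁, h₂, (floor_le_ceiling hr he hm h₁ h₂).trans h.ge, h.le⟩

/-! ### How far one link can reach -/

theorem tangent_le_of_mem (hr : 5 ≤ r) (he : e + 1 < r) (hm : 0 < m) (i : ℕ) {p : ℝ × ℝ}
    (hp : p ∈ corridor r m e) : tangent r i p.1 ≤ p.2 :=
  (tangent_le_floor hr he hm i hp.1 hp.2.1).trans hp.2.2.1

theorem ceiling_gate (hr : 5 ≤ r) (hm : 0 < m) {i : ℕ} (hi : i < 2 * m) :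
    ceiling r m (gate r m i).1 = (gate r m i).2 := by
  have := interp_node (X := fun j => (upper r m j).1) (Y := fun j => (upper r m j).2)
    (upper_lt hr hm) (i := i + 1) (by omega)
  simp only [upper_gate hi] at this
  exact this

/-- How far a link that starts before the `i`-th tangent point, up to an advance `α`, can get. -/
theorem link_advance (hr : 5 ≤ r) (he : e + 1 < r) (hm : 0 < m) {i : ℕ} (hi : i < 2 * m)
    {p p' : ℝ × ℝ} (h : segment ℝ p p' ⊆ corridor r m e) {α : ℝ} (h₀ : 0 ≤ α)
    (hα : 2 * α < gateWidth r m i) (hp : p.1 ≤ 2 * r * i + α) :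
    (p'.1 - 2 * r * (i + 1)) * (gateWidth r m i - 2 * α) ≤ α * (2 * r - gateWidth r m i) := by
  obtain ⟨ha₁, ha₂⟩ := gateWidth_mem (m := m) (i := i) hr
  have t₁ := tangent_le_of_mem hr he hm i (h (left_mem_segment ℝ p p'))
  have t₂ := tangent_le_of_mem hr he hm (i + 1) (h (right_mem_segment ℝ p p'))
  have hg := ceiling_gate hr hm hi
  have hr' : (5 : ℝ) ≤ r := by exact_mod_cast hr
  -- A link that ends before the gate has not reached the next tangent point, so its advance is
  -- negative.
  rcases le_or_gt p'.1 (gate r m i).1 with hx | hx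
  · simp only [gate] at hx
    have : p'.1 - 2 * r * (i + 1) ≤ 0 := by nlinarith
    nlinarith [mul_nonneg h₀ (by linarith : 0 ≤ 2 * r - gateWidth r m i)]
  have hx' : p.1 < (gate r m i).1 := by
    simp only [gate]
    linarith
  have hd : 0 < p'.1 - p.1 := by linarith
  set τ := ((gate r m i).1 - p.1) / (p'.1 - p.1) with hτ
  have hτd : τ * (p'.1 - p.1) = (gate r m i).1 - p.1 := div_mul_cancel₀ _ hd.ne'
  have hz : p + τ • (p' - p) ∈ segment ℝ p p' := by
    rw [segment_eq_image']
    exact ⟨τ, ⟨div_nonneg (by linarith) hd.le, (div_le_one hd).2 (by linarith)⟩, rfl⟩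
  -- At the abscissa of the gate the link is no higher than the gate.
  have hz := (h hz).2.2.2
  simp only [Prod.fst_add, Prod.snd_add, Prod.smul_fst, Prod.smul_snd, Prod.fst_sub,
    Prod.snd_sub, smul_eq_mul, hτd, add_sub_cancel, hg] at hz
  have hz' : p.2 * (p'.1 - p.1) + ((gate r m i).1 - p.1) * (p'.2 - p.2) ≤
      (gate r m i).2 * (p'.1 - p.1) := by
    rw [← hτd]
    nlinarith
  clear hz hτd
  obtain ⟨x, y⟩ := p
  obtain ⟨x', y'⟩ := p'
  simp only [gate, tangent] at *
  push_cast at t₂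
  generalize gateWidth r m i = a at *
  obtain ⟨w, rfl⟩ : ∃ w, x' = 2 * r * (i + 1) + w := ⟨x' - 2 * r * (i + 1), by ring⟩
  obtain ⟨u, rfl⟩ : ∃ u, x = 2 * r * i + u := ⟨x - 2 * r * i, by ring⟩
  have e₁ := mul_le_mul_of_nonneg_left t₁
    (by linarith : 0 ≤ 2 * r * ((i : ℝ) + 1) + w - (2 * r * i + a))
  have e₂ := mul_le_mul_of_nonneg_left t₂ (by linarith : 0 ≤ 2 * r * (i : ℝ) + a - (2 * r * i + u))
  -- Heights are measured from tangent `i`: the gate has height `a`, the end point at least `2 r + 2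
  -- w`, the starting point at least `0`. Expanding gives `w (a - 2 u) ≤ u (2 r - a)`.
  have e₃ : (a - u) * (2 * r + 2 * w) ≤ a * (2 * r + w - u) := by nlinarith
  have hu : u ≤ α := by linarith
  rcases le_or_gt w 0 with hw | hw
  · nlinarith [mul_nonneg h₀ (by linarith : 0 ≤ 2 * r - a)]
  · nlinarith [mul_le_mul_of_nonneg_right hu (by linarith : 0 ≤ 2 * r - a + 2 * w)]

/-! ### Links between points of the lower wall -/

/-- The difference is `2 r d ^ 2 + 2 d u` with `d = i - j`, nonnegative because `u ≤ 1 ≤ r`. So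
small advances along a tangent stay on the floor. -/
theorem tangent_le_tangent (hr : 5 ≤ r) (i j : ℕ) {u : ℝ} (h₀ : 0 ≤ u) (h₁ : u ≤ 1) :
    tangent r j (2 * r * i + u) ≤ tangent r i (2 * r * i + u) := by
  have hr' : (5 : ℝ) ≤ r := by exact_mod_cast hr
  have h := sq_add_self_nonneg j i
  simp only [tangent]
  nlinarith [mul_nonneg h₀ h, mul_nonneg (sub_nonneg.2 h₁) (sq_nonneg ((i : ℝ) - j)),
    mul_nonneg (by linarith : (0 : ℝ) ≤ r - 1) (sq_nonneg ((i : ℝ) - j))]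

variable (r) in
/-- The point on the `i`-th tangent with advance `u` over the tangent point. -/
def bend (i : ℕ) (u : ℝ) : ℝ × ℝ := (2 * r * i + u, tangent r i (2 * r * i + u))

theorem bend_snd (hr : 5 ≤ r) (he : e + 1 < r) (hm : 0 < m) {i : ℕ} {u : ℝ} (h₀ : 0 ≤ u)
    (h₁ : u ≤ 1) (h₂ : 1 ≤ (bend r i u).1) (h₃ : (bend r i u).1 ≤ (target r m).1) :
    (bend r i u).2 = floor r m e (bend r i u).1 := by
  apply le_antisymm
  · exact tangent_le_floor hr he hm i h₂ h₃
  · obtain ⟨j, hj⟩ := exists_floor_eq_tangent hr he hm h₂ h₃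
    rw [hj]
    exact tangent_le_tangent hr i j h₀ h₁

theorem bend_mem_boundary (hr : 5 ≤ r) (he : e + 1 < r) (hm : 0 < m) {i : ℕ} {u : ℝ}
    (h₀ : 0 ≤ u) (h₁ : u ≤ 1) (h₂ : 1 ≤ (bend r i u).1) (h₃ : (bend r i u).1 ≤ (target r m).1) :
    bend r i u ∈ (corridorPolygon r m e).boundary ℝ := by
  rw [boundary_corridorPolygon hr he hm]
  exact ⟨h₂, h₃, Or.inl (bend_snd hr he hm h₀ h₁ h₂ h₃)⟩

/-- The floor is a maximum of tangents, so the link stays above it once its ends do. Over the link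
the ceiling has only two pieces, which meet at the gate, so staying below it is a condition at the
ends and the gate. -/
theorem link_subset (hr : 5 ≤ r) (he : e + 1 < r) (hm : 0 < m) {i : ℕ} (hi : i < 2 * m)
    {u w : ℝ} (hu₀ : 0 ≤ u) (hu₁ : u ≤ 1) (hw₀ : 0 ≤ w) (hw₁ : w ≤ 1)
    (h₁ : 1 ≤ (bend r i u).1) (h : w * gateWidth r m i ≤ u * (2 * r - gateWidth r m i)) :
    segment ℝ (bend r i u) (bend r (i + 1) w) ⊆ corridor r m e := by
  have hr' : (5 : ℝ) ≤ r := by exact_mod_cast hr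
  have hi' : (i : ℝ) + 1 ≤ 2 * m := by exact_mod_cast hi
  obtain ⟨ha₁, ha₂⟩ := gateWidth_mem (m := m) (i := i) hr
  have hx : 0 < (bend r (i + 1) w).1 - (bend r i u).1 := by
    simp only [bend]
    push_cast
    linarith
  have h₂ : (bend r (i + 1) w).1 ≤ (target r m).1 := by
    simp only [bend, target]
    push_cast
    nlinarith
  have m₁ := boundary_subset_corridor hr he hm
    (bend_mem_boundary hr he hm hu₀ hu₁ h₁ (by linarith))
  have m₂ := boundary_subset_corridor hr he hm
    (bend_mem_boundary hr he hm hw₀ hw₁ (by linarith) h₂)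
  obtain ⟨c, hc⟩ : ∃ c, c * ((bend r (i + 1) w).1 - (bend r i u).1) =
      (bend r (i + 1) w).2 - (bend r i u).2 := ⟨_, div_mul_cancel₀ _ hx.ne'⟩
  obtain ⟨d, hd⟩ : ∃ d, d = (bend r i u).2 - c * (bend r i u).1 := ⟨_, rfl⟩
  have d₁ : c * (bend r i u).1 + d = (bend r i u).2 := by linarith
  have d₂ : c * (bend r (i + 1) w).1 + d = (bend r (i + 1) w).2 := by linarith
  have dg : c * (gate r m i).1 + d ≤ ceiling r m (gate r m i).1 := by
    rw [ceiling_gate hr hm hi]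
    refine le_of_mul_le_mul_right ?_ hx
    have : (c * (gate r m i).1 + d) * ((bend r (i + 1) w).1 - (bend r i u).1) =
        (bend r i u).2 * ((bend r (i + 1) w).1 - (bend r i u).1) +
        ((gate r m i).1 - (bend r i u).1) * ((bend r (i + 1) w).2 - (bend r i u).2) := by
      rw [hd, ← hc]
      ring
    rw [this]
    simp only [gate, bend, tangent]
    push_cast
    nlinarith
  have g₁ : (bend r i u).1 ≤ (gate r m i).1 := by
    simp only [gate, bend]
    linarith
  have g₂ : (gate r m i).1 ≤ (bend r (i + 1) w).1 := by
    simp only [gate, bend]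
    push_cast
    linarith
  have hX := upper_lt hr hm
  have b₁ : (upper r m i).1 ≤ (bend r i u).1 := by
    rcases i with - | i
    · exact h₁
    · rw [upper_gate (by omega)]
      have := (gateWidth_mem (m := m) (i := i) hr).2
      simp only [gate, bend]
      push_cast
      linarith
  have b₂ : (bend r (i + 1) w).1 ≤ (upper r m (i + 1 + 1)).1 := by
    rcases lt_or_ge (i + 1) (2 * m) with hi | hi
    · rw [upper_gate hi]
      have := (gateWidth_mem (m := m) (i := i + 1) hr).1
      simp only [gate, bend]
      linarith
    · obtain h : i + 1 = 2 * m := by omega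
      rwa [h, upper_target, ← h]
  rintro z hz
  have hz₁ : (bend r i u).1 ≤ z.1 ∧ z.1 ≤ (bend r (i + 1) w).1 ∧ z.2 = c * z.1 + d := by
    rw [segment_eq_image'] at hz
    obtain ⟨τ, ⟨h0, h1⟩, rfl⟩ := hz
    simp only [Prod.fst_add, Prod.snd_add, Prod.smul_fst, Prod.smul_snd, Prod.fst_sub,
      Prod.snd_sub, smul_eq_mul]
    refine ⟨by nlinarith, by nlinarith, ?_⟩
    rw [← hc, hd]
    ring
  obtain ⟨x, y⟩ := z
  obtain ⟨z₁, z₂, hy⟩ := hz₁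
  simp only at z₁ z₂ hy
  subst hy
  refine ⟨h₁.trans z₁, z₂.trans h₂, ?_, ?_⟩
  · obtain ⟨j, hj⟩ := exists_floor_eq_tangent hr he hm (h₁.trans z₁) (z₂.trans h₂)
    have f₁ := tangent_le_of_mem hr he hm j m₁
    have f₂ := tangent_le_of_mem hr he hm j m₂
    simp only
    rw [hj]
    rw [← d₁] at f₁
    rw [← d₂] at f₂
    simp only [tangent] at f₁ f₂ ⊢
    rcases le_total (2 * (j : ℝ)) c with hcj | hcj <;> nlinarith
  · rcases le_total x (gate r m i).1 with hxg | hxg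
    · exact affine_le_interp_of_piece hX (i := i) (by omega) b₁ (upper_gate hi ▸ le_rfl) z₁ hxg
        (d₁.trans_le m₁.2.2.2) dg
    · exact affine_le_interp_of_piece hX (i := i + 1) (by omega) (upper_gate hi ▸ le_rfl) b₂
        hxg z₂ dg (d₂.trans_le m₂.2.2.2)

end corridor

/-! ### Bit sizes of rational numbers -/

/-- A rational number just above an integer needs many bits. -/
theorem not_representable_of_near_int {x B : ℝ} {z : ℤ} {r m : ℕ} (hr : 1 ≤ r) (h₁ : (z : ℝ) < x)
    (h₂ : x ≤ z + (1 / (r : ℝ)) ^ m) (hB : B ≤ m * Real.log r) : ¬ Representable x B := by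
  rintro ⟨q, rfl, hq⟩
  have hr' : (1 : ℝ) ≤ r := by exact_mod_cast hr
  have hden : (0 : ℝ) < q.den := by exact_mod_cast q.den_pos
  have hnum : (q : ℝ) * q.den = q.num := by exact_mod_cast Rat.mul_den_eq_num q
  -- The product is a positive integer.
  have hint : (1 : ℝ) ≤ ((q : ℝ) - z) * q.den := by
    have h : (0 : ℝ) < ((q : ℝ) - z) * q.den := mul_pos (sub_pos.2 h₁) hden
    have e : ((q : ℝ) - z) * q.den = ((q.num - z * q.den : ℤ) : ℝ) := by
      push_cast
      rw [← hnum]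
      ring
    rw [e] at h ⊢
    exact_mod_cast h
  have hle : (r : ℝ) ^ m ≤ q.den := by
    have h : ((q : ℝ) - z) * q.den ≤ (1 / (r : ℝ)) ^ m * q.den :=
      mul_le_mul_of_nonneg_right (by linarith) hden.le
    have h' := hint.trans h
    rwa [one_div, inv_pow, inv_mul_eq_div, one_le_div (by positivity)] at h'
  have hsize : (q.den : ℝ) < 2 ^ q.den.size := by exact_mod_cast Nat.lt_size_self q.den
  have hlog : m * Real.log r < q.den.size * Real.log 2 := by
    rw [← Real.log_pow, ← Real.log_pow]
    exact Real.log_lt_log (by positivity) (hle.trans_lt hsize)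
  have hlog2 : Real.log 2 ≤ 1 := Real.log_two_lt_d9.le.trans (by norm_num)
  have hb : (q.den.size : ℝ) ≤ ratBits q := by
    unfold ratBits
    push_cast
    linarith [Nat.cast_nonneg (α := ℝ) q.num.natAbs.size]
  nlinarith [Nat.cast_nonneg (α := ℝ) q.den.size]

theorem representable_natCast {n z : ℕ} (hn : 3 ≤ n) (hz : z ≤ n ^ 4) :
    Representable z (11 * Real.log n) := by
  refine ⟨z, by simp, ?_⟩
  have hn' : (3 : ℝ) ≤ n := by exact_mod_cast hn
  have hlog : 1 ≤ Real.log n := by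
    rw [Real.le_log_iff_exp_le (by linarith)]
    linarith [Real.exp_one_lt_d9]
  have hlog2 : 1 / 2 ≤ Real.log 2 := le_trans (by norm_num) Real.log_two_gt_d9.le
  have hb : (ratBits (z : ℚ) : ℝ) = z.size + 1 := by simp [ratBits]
  rw [hb]
  rcases Nat.eq_zero_or_pos z.size with h | h
  · rw [h]
    push_cast
    linarith
  obtain ⟨k, hk⟩ : ∃ k, z.size = k + 1 := ⟨z.size - 1, by omega⟩
  -- This yields `k log 2 ≤ 4 log n`, so `k ≤ 8 log n`. The total `k + 2`, with one bit for the
  -- denominator, is then below `11 log n` since `1 ≤ log n`.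
  have h2 : 2 ^ k ≤ z := Nat.lt_size.1 (by omega)
  have h3 : (2 : ℝ) ^ k ≤ n ^ 4 := by exact_mod_cast h2.trans hz
  have h4 := Real.log_le_log (by positivity) h3
  rw [Real.log_pow, Real.log_pow] at h4
  push_cast at h4
  rw [hk]
  push_cast
  nlinarith [Nat.cast_nonneg (α := ℝ) k]

/-! ### Paths through the corridor -/

/-- A polygonal path as a sequence indexed by natural numbers. -/
theorem IsLinkPath.exists_seq {A D : Set (ℝ × ℝ)} {s t : ℝ × ℝ} {k : ℕ}
    {p : Fin (k + 1) → ℝ × ℝ} (h : IsLinkPath A D s t k p) :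
    ∃ q : ℕ → ℝ × ℝ, q 0 = s ∧ q k = t ∧ (∀ i : Fin (k + 1), q i = p i) ∧
      ∀ i < k, segment ℝ (q i) (q (i + 1)) ⊆ D := by
  obtain ⟨h₀, h₁, -, h₃⟩ := h
  have hq : ∀ i : Fin (k + 1), p (Fin.ofNat (k + 1) i) = p i := fun i => by simp
  refine ⟨fun i => p (Fin.ofNat (k + 1) i), ?_, ?_, hq, ?_⟩
  · rw [← h₀]
    exact hq 0
  · rw [← h₁]
    exact hq (Fin.last k)
  · intro i hi
    have e₁ := hq (Fin.castSucc ⟨i, hi⟩)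
    have e₂ := hq (Fin.succ ⟨i, hi⟩)
    simp only [Fin.val_castSucc, Fin.val_succ] at e₁ e₂
    simp only [e₁, e₂]
    exact h₃ ⟨i, hi⟩

theorem isLinkPath_mono {A A' D : Set (ℝ × ℝ)} (hA : A ⊆ A') {s t : ℝ × ℝ} {k : ℕ}
    {p : Fin (k + 1) → ℝ × ℝ} (h : IsLinkPath A D s t k p) : IsLinkPath A' D s t k p :=
  ⟨h.1, h.2.1, fun i => hA (h.2.2.1 i), h.2.2.2⟩

section corridor

variable {r m e : ℕ}

/-- A path that lags behind keeps lagging behind. -/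
theorem lag (hr : 5 ≤ r) (he : e + 1 < r) (hm : 0 < m) {q : ℕ → ℝ × ℝ} {k : ℕ}
    (hq : ∀ i < k, segment ℝ (q i) (q (i + 1)) ⊆ corridor r m e) {l c : ℕ}
    (h : (q l).1 ≤ 2 * r * (l + c : ℕ)) {l' : ℕ} (hl : l ≤ l') (hk : l' ≤ k)
    (hc : l' + c ≤ 2 * m) : (q l').1 ≤ 2 * r * (l' + c : ℕ) := by
  induction l', hl using Nat.le_induction with
  | base => exact h
  | succ i hi ih =>
    have ha := (gateWidth_mem (m := m) (i := i + c) hr).1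
    have := link_advance hr he hm (i := i + c) (by omega) (hq i hk) le_rfl (by linarith)
      (by linarith [ih (by omega) (by omega)])
    rw [zero_mul, mul_zero, sub_zero] at this
    have := nonpos_of_mul_nonpos_left this (by linarith)
    push_cast at this ⊢
    linarith

/-- In the first half of the corridor, every link shrinks the possible advance. -/
theorem advance_le (hr : 5 ≤ r) (he : e + 1 < r) (hm : 0 < m) {q : ℕ → ℝ × ℝ} {k : ℕ}
    (hq : ∀ i < k, segment ℝ (q i) (q (i + 1)) ⊆ corridor r m e) (h₀ : (q 0).1 = 1) {i : ℕ}
    (hi : i ≤ m) (hk : i ≤ k) : (q i).1 ≤ 2 * r * i + (1 / (r : ℝ)) ^ i := by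
  have hr' : (5 : ℝ) ≤ r := by exact_mod_cast hr
  induction i with
  | zero => simp [h₀]
  | succ i ih =>
    have hα₀ : 0 ≤ (1 / (r : ℝ)) ^ i := by positivity
    have hα₁ : (1 / (r : ℝ)) ^ i ≤ 1 :=
      pow_le_one₀ (by positivity) ((div_le_one (by linarith)).2 (by linarith))
    have ha : gateWidth r m i = 2 * r - 1 := if_pos hi
    have := link_advance hr he hm (i := i) (by omega) (hq i hk) hα₀ (by linarith)
      (ih (by omega) (by omega))
    rw [ha] at this
    rw [pow_succ]
    push_cast
    generalize (1 / (r : ℝ)) ^ i = α at *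
    suffices (q (i + 1)).1 - 2 * r * (i + 1) ≤ α * (1 / r) by linarith
    -- The factor `2 r - 1 - 2 α` is at least `2 r - 3`, hence at least `r`.
    rw [mul_one_div, le_div_iff₀ (by linarith)]
    rcases le_or_gt ((q (i + 1)).1 - 2 * r * (i + 1)) 0 with h | h <;> nlinarith

variable (r m) in
/-- The advance of an optimal path after `i` links. -/
noncomputable def advance (i : ℕ) : ℝ := (1 / (2 * r - 1 : ℝ)) ^ min i (2 * m - i)

theorem advance_mem (hr : 5 ≤ r) (i : ℕ) : 0 ≤ advance r m i ∧ advance r m i ≤ 1 := by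
  have hr' : (5 : ℝ) ≤ r := by exact_mod_cast hr
  have h : 0 ≤ 1 / (2 * r - 1 : ℝ) := div_nonneg zero_le_one (by linarith)
  exact ⟨pow_nonneg h _, pow_le_one₀ h ((div_le_one (by linarith)).2 (by linarith))⟩

/-- Equality holds in both halves: the advance is divided by `2 r - 1` up to the middle and
multiplied by it afterwards. -/
theorem advance_succ (hr : 5 ≤ r) {i : ℕ} (hi : i < 2 * m) :
    advance r m (i + 1) * gateWidth r m i ≤ advance r m i * (2 * r - gateWidth r m i) := by
  have hr' : (5 : ℝ) ≤ r := by exact_mod_cast hr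
  have hne : (2 * r - 1 : ℝ) ≠ 0 := by linarith
  unfold advance gateWidth
  split_ifs with h
  · rw [show min (i + 1) (2 * m - (i + 1)) = i + 1 by omega, show min i (2 * m - i) = i by omega,
      pow_succ, mul_assoc, one_div_mul_cancel hne]
    linarith
  · rw [show min (i + 1) (2 * m - (i + 1)) = 2 * m - i - 1 by omega,
      show min i (2 * m - i) = 2 * m - i - 1 + 1 by omega, pow_succ, mul_assoc,
      one_div_mul_cancel hne]

theorem bend_zero : bend r 0 (advance r m 0) = (1, 0) := by simp [bend, advance, tangent]

theorem bend_last : bend r (2 * m) (advance r m (2 * m)) = target r m := by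
  simp only [bend, advance, tangent, target, Nat.sub_self, Nat.min_zero, pow_zero]
  push_cast
  refine Prod.ext ?_ ?_ <;> simp only <;> ring

theorem isLinkPath_bend (hr : 5 ≤ r) (he : e + 1 < r) (hm : 0 < m) :
    IsLinkPath ((corridorPolygon r m e).boundary ℝ) (corridor r m e) (1, 0) (target r m) (2 * m)
      fun i => bend r i (advance r m i) := by
  have hr' : (5 : ℝ) ≤ r := by exact_mod_cast hr
  have h₁ : ∀ i, 1 ≤ (bend r i (advance r m i)).1 := by
    intro i
    rcases i with - | i
    · rw [bend_zero]
    · have := (advance_mem (m := m) hr (i + 1)).1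
      simp only [bend]
      push_cast
      nlinarith [mul_nonneg (Nat.cast_nonneg (α := ℝ) r) (Nat.cast_nonneg (α := ℝ) i)]
  refine ⟨bend_zero, bend_last, fun i => ?_, fun i => ?_⟩
  · obtain ⟨h₂, h₃⟩ := advance_mem (m := m) hr i
    refine bend_mem_boundary hr he hm h₂ h₃ (h₁ i) ?_
    have : ((i : ℕ) : ℝ) ≤ 2 * m := by exact_mod_cast Nat.lt_succ_iff.1 i.2
    simp only [bend, target]
    nlinarith
  · obtain ⟨h₂, h₃⟩ := advance_mem (m := m) hr i
    obtain ⟨h₄, h₅⟩ := advance_mem (m := m) hr (i + 1)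
    exact link_subset hr he hm i.2 h₂ h₃ h₄ h₅ (h₁ i) (advance_succ hr i.2)

theorem two_mul_le_of_isLinkPath (hr : 5 ≤ r) (he : e + 1 < r) (hm : 0 < m) {A : Set (ℝ × ℝ)}
    {k : ℕ} {p : Fin (k + 1) → ℝ × ℝ}
    (h : IsLinkPath A (corridor r m e) (1, 0) (target r m) k p) : 2 * m ≤ k := by
  by_contra! hk
  obtain ⟨q, h₀, h₁, -, hq⟩ := h.exists_seq
  have hr' : (5 : ℝ) ≤ r := by exact_mod_cast hr
  have hc : (1 : ℝ) ≤ (2 * m - k : ℕ) := by exact_mod_cast (by omega : 1 ≤ 2 * m - k)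
  -- With fewer than `2 m` links the start already counts as lagging behind tangent point `2 m - k`,
  -- so the path ends at or before tangent point `2 m`, short of the target.
  have := lag hr he hm hq (l := 0) (c := 2 * m - k) (by rw [h₀, zero_add]; simp only; nlinarith)
    (Nat.zero_le k) le_rfl (by omega)
  rw [h₁, show k + (2 * m - k) = 2 * m by omega] at this
  simp only [target] at this
  push_cast at this
  linarith

theorem isLinkDist (hr : 5 ≤ r) (he : e + 1 < r) (hm : 0 < m) {A : Set (ℝ × ℝ)}
    (hA : (corridorPolygon r m e).boundary ℝ ⊆ A) :
    IsLinkDist A (corridor r m e) (1, 0) (target r m) (2 * m) :=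
  ⟨⟨_, isLinkPath_mono hA (isLinkPath_bend hr he hm)⟩, fun _ ⟨_, hp⟩ =>
    two_mul_le_of_isLinkPath hr he hm hp⟩

theorem exists_complex_bend (hr : 5 ≤ r) (he : e + 1 < r) (hm : 0 < m) {A : Set (ℝ × ℝ)}
    {p : Fin (2 * m + 1) → ℝ × ℝ}
    (h : IsLinkPath A (corridor r m e) (1, 0) (target r m) (2 * m) p) {B : ℝ}
    (hB : B ≤ m * Real.log r) :
    ∃ i : Fin (2 * m + 1), i ≠ 0 ∧ i ≠ Fin.last (2 * m) ∧ ¬ PointRepresentable (p i) B := by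
  obtain ⟨q, h₀, h₁, hp, hq⟩ := h.exists_seq
  refine ⟨⟨m, by omega⟩, ?_, ?_, fun hrep => ?_⟩
  · simp only [ne_eq, Fin.ext_iff, Fin.val_zero]
    omega
  · simp only [ne_eq, Fin.ext_iff, Fin.val_last]
    omega
  rw [← hp] at hrep
  refine not_representable_of_near_int (z := 2 * r * m) (m := m) (by omega) ?_ ?_ hB hrep.1
  -- A nonpositive advance at the middle would persist to the target, whose advance is 1.
  · by_contra! hle
    push_cast at hle
    have := lag hr he hm hq (l := m) (c := 0) (by simpa using hle) (l' := 2 * m) (by omega) le_rfl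
      le_rfl
    rw [h₁] at this
    simp only [target] at this
    push_cast at this
    linarith
  · have := advance_le hr he hm hq (by rw [h₀]) (i := m) le_rfl (by omega)
    push_cast
    exact this

/-! ### Bit sizes of the vertices -/

theorem representable_of_eq {n z : ℕ} (hn : 3 ≤ n) {x : ℝ} (hx : x = z) (hz : z ≤ n ^ 4) :
    Representable x (11 * Real.log n) :=
  hx ▸ representable_natCast hn hz

theorem pointRepresentable_start (hr : 5 ≤ r) :
    PointRepresentable ((1, 0) : ℝ × ℝ) (11 * Real.log r) :=
  ⟨representable_of_eq (z := 1) (by omega) (by simp) (Nat.one_le_pow _ _ (by omega)),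
    representable_of_eq (z := 0) (by omega) (by simp) (Nat.zero_le _)⟩

theorem pointRepresentable_target (hr : 5 ≤ r) (hmr : 4 * m + 2 ≤ r) :
    PointRepresentable (target r m) (11 * Real.log r) := by
  refine ⟨representable_of_eq (z := 4 * r * m + 1) (by omega) (by simp [target]) ?_,
    representable_of_eq (z := 8 * r * m ^ 2 + 4 * m) (by omega) (by simp [target]) ?_⟩
  · have : r ^ 2 ≤ r ^ 4 := Nat.pow_le_pow_right (by omega) (by omega)
    nlinarith
  · have : r ^ 3 ≤ r ^ 4 := Nat.pow_le_pow_right (by omega) (by omega)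
    have h₁ : (4 * m + 2) ^ 2 ≤ r ^ 2 := Nat.pow_le_pow_left hmr 2
    have h₂ := Nat.mul_le_mul_left r h₁
    nlinarith

theorem pointRepresentable_valley (hr : 5 ≤ r) (hmr : 4 * m + 2 ≤ r) {i : ℕ} (hi : i < 2 * m) :
    PointRepresentable (valley r i) (11 * Real.log r) := by
  refine ⟨representable_of_eq (z := 2 * r * i + r) (by omega) (by simp [valley]) ?_,
    representable_of_eq (z := 2 * r * (i ^ 2 + i)) (by omega) (by simp [valley]) ?_⟩
  · have : r ^ 2 ≤ r ^ 4 := Nat.pow_le_pow_right (by omega) (by omega)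
    nlinarith
  · have : r ^ 3 ≤ r ^ 4 := Nat.pow_le_pow_right (by omega) (by omega)
    have h₁ : (2 * i + 2) ^ 2 ≤ r ^ 2 := Nat.pow_le_pow_left (by omega) 2
    have h₂ := Nat.mul_le_mul_left r h₁
    nlinarith

theorem pointRepresentable_gate (hr : 5 ≤ r) (hmr : 4 * m + 2 ≤ r) {i : ℕ} (hi : i < 2 * m) :
    PointRepresentable (gate r m i) (11 * Real.log r) := by
  obtain ⟨a, ha, har⟩ : ∃ a : ℕ, gateWidth r m i = a ∧ a ≤ 2 * r := by
    unfold gateWidth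
    split_ifs
    · refine ⟨2 * r - 1, ?_, by omega⟩
      rw [Nat.cast_sub (by omega)]
      push_cast
      ring
    · exact ⟨1, by simp, by omega⟩
  refine ⟨representable_of_eq (z := 2 * r * i + a) (by omega) (by simp [gate, ha]) ?_,
    representable_of_eq (z := 2 * r * i ^ 2 + (2 * i + 1) * a) (by omega)
      (by simp [gate, ha]) ?_⟩
  · have : r ^ 2 ≤ r ^ 4 := Nat.pow_le_pow_right (by omega) (by omega)
    nlinarith
  · have : r ^ 3 ≤ r ^ 4 := Nat.pow_le_pow_right (by omega) (by omega)
    have h₁ : (2 * i + 2) ^ 2 ≤ r ^ 2 := Nat.pow_le_pow_left (by omega) 2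
    have h₂ := Nat.mul_le_mul_left r h₁
    have h₃ := Nat.mul_le_mul_left (2 * i + 1) har
    nlinarith

theorem pointRepresentable_vertex (hr : 5 ≤ r) (he : e + 1 < r) (hmr : 4 * m + 2 ≤ r)
    (i : Fin (e + 1 + 2 * m + (2 * m + 1))) :
    PointRepresentable (corridorPolygon r m e i) (11 * Real.log r) := by
  have ht := pointRepresentable_target hr hmr
  simp only [corridorPolygon, chainPolygon, chainVertex]
  split_ifs with h
  · rcases lower_cases r m e i h with ⟨h', e₁⟩ | ⟨d, hd, -, e₁⟩ | ⟨h', e₁⟩ <;> rw [e₁]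
    · refine ⟨representable_of_eq (z := 1 + i) (by omega) (by simp) ?_,
        (pointRepresentable_start hr).2⟩
      have : r ≤ r ^ 4 := Nat.le_self_pow (by omega) r
      omega
    · exact pointRepresentable_valley hr hmr hd
    · exact ht
  · rcases upper_cases r m (e + 1 + 2 * m + (2 * m + 1) - i) (by omega) with
      ⟨h', e₁⟩ | ⟨d, hd, -, e₁⟩ | ⟨h', e₁⟩ <;> rw [e₁]
    · exact pointRepresentable_start hr
    · exact pointRepresentable_gate hr hmr hd
    · exact ht

end corridor

/-! ### The polygon for each number of vertices -/

/-- For every large `n` there is a polygon with `n` vertices in which the link distance of two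
boundary points is linear, and every minimum-link path between them has a complex bend, whether or
not the bends are restricted to the boundary. -/
theorem exists_polygon (n : ℕ) (hn : 10 ≤ n) :
    ∃ (P : Polygon (ℝ × ℝ) n) (D : Set (ℝ × ℝ)) (s t : ℝ × ℝ) (k : ℕ),
      IsSimple P ∧ IsRegion P D ∧ s ∈ P.boundary ℝ ∧ t ∈ P.boundary ℝ ∧ P.boundary ℝ ⊆ D ∧
      (∀ i, PointRepresentable (P i) (11 * Real.log n)) ∧
      PointRepresentable s (11 * Real.log n) ∧ PointRepresentable t (11 * Real.log n) ∧
      1 / 4 * (n : ℝ) ≤ k ∧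
      ∀ A, P.boundary ℝ ⊆ A → IsLinkDist A D s t k ∧
        ∀ p : Fin (k + 1) → ℝ × ℝ, IsLinkPath A D s t k p →
          ∃ i : Fin (k + 1), i ≠ 0 ∧ i ≠ Fin.last k ∧
            ¬ PointRepresentable (p i) (1 / 2 * k * Real.log n) := by
  -- The `e` extra collinear vertices on the axis adjust the number of vertices to exactly `n`.
  obtain ⟨m, e, he, hne⟩ : ∃ m e, e < 4 ∧ n = e + 1 + 2 * m + (2 * m + 1) :=
    ⟨(n - 2) / 4, (n - 2) % 4, by omega, by omega⟩
  obtain ⟨r, hr⟩ : ∃ r, r = n := ⟨n, rfl⟩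
  have hr5 : 5 ≤ r := by omega
  have her : e + 1 < r := by omega
  have hm : 2 ≤ m := by omega
  have hm0 : 0 < m := by omega
  have hmr : 4 * m + 2 ≤ r := by omega
  -- Here `n ≤ 4 m + 5 ≤ 8 m`, because `10 ≤ n` forces `2 ≤ m`.
  have hk : 1 / 4 * (r : ℝ) ≤ (2 * m : ℕ) := by
    have : r ≤ 4 * (2 * m) := by omega
    have : (r : ℝ) ≤ 4 * (2 * m : ℕ) := by exact_mod_cast this
    linarith
  subst hne
  have hr' : (r : ℝ) = (e + 1 + 2 * m + (2 * m + 1) : ℕ) := congrArg _ hr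
  rw [← hr']
  have hpath := isLinkPath_bend hr5 her hm0
  refine ⟨corridorPolygon r m e, corridor r m e, (1, 0), target r m, 2 * m,
    isSimple_corridorPolygon hr5 her hm0, isRegion_corridor hr5 her hm0,
    hpath.1 ▸ hpath.2.2.1 0, hpath.2.1 ▸ hpath.2.2.1 (Fin.last _),
    boundary_subset_corridor hr5 her hm0, pointRepresentable_vertex hr5 her hmr,
    pointRepresentable_start hr5, pointRepresentable_target hr5 hmr, hk,
    fun A hA => ⟨isLinkDist hr5 her hm0 hA, fun p hp => ?_⟩⟩
  refine exists_complex_bend hr5 her hm0 hp ?_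
  push_cast
  linarith

end MinLink

theorem mainTheorem5 :
    -- bends (and `s`, `t`) restricted to the edges of the polygon
    (∃ C c δ : ℝ, 0 < C ∧ 0 < c ∧ 0 < δ ∧ ∃ N : ℕ, ∀ n : ℕ, N ≤ n →
      ∃ (P : Polygon (ℝ × ℝ) n) (D : Set (ℝ × ℝ)) (s t : ℝ × ℝ) (k : ℕ),
        MinLink.IsSimple P ∧ MinLink.IsRegion P D ∧
        s ∈ P.boundary ℝ ∧ t ∈ P.boundary ℝ ∧
        (∀ i, MinLink.PointRepresentable (P i) (C * Real.log n)) ∧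
        MinLink.PointRepresentable s (C * Real.log n) ∧
        MinLink.PointRepresentable t (C * Real.log n) ∧
        MinLink.IsLinkDist (P.boundary ℝ) D s t k ∧
        δ * n ≤ k ∧
        ∀ p : Fin (k + 1) → ℝ × ℝ, MinLink.IsLinkPath (P.boundary ℝ) D s t k p →
          ∃ i : Fin (k + 1), i ≠ 0 ∧ i ≠ Fin.last k ∧
            ¬ MinLink.PointRepresentable (p i) (c * k * Real.log n)) ∧
    -- unrestricted bends
    (∃ C c δ : ℝ, 0 < C ∧ 0 < c ∧ 0 < δ ∧ ∃ N : ℕ, ∀ n : ℕ, N ≤ n →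
      ∃ (P : Polygon (ℝ × ℝ) n) (D : Set (ℝ × ℝ)) (s t : ℝ × ℝ) (k : ℕ),
        MinLink.IsSimple P ∧ MinLink.IsRegion P D ∧
        s ∈ D ∧ t ∈ D ∧
        (∀ i, MinLink.PointRepresentable (P i) (C * Real.log n)) ∧
        MinLink.PointRepresentable s (C * Real.log n) ∧
        MinLink.PointRepresentable t (C * Real.log n) ∧
        MinLink.IsLinkDist D D s t k ∧
        δ * n ≤ k ∧
        ∀ p : Fin (k + 1) → ℝ × ℝ, MinLink.IsLinkPath D D s t k p →
          ∃ i : Fin (k + 1), i ≠ 0 ∧ i ≠ Fin.last k ∧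
            ¬ MinLink.PointRepresentable (p i) (c * k * Real.log n)) := by
  constructor
  all_goals
    -- With `k = 2 m` and `r = n`, the choice `c = 1 / 2` makes `c k log n` equal to `m log r`.
    refine ⟨11, 1 / 2, 1 / 4, by norm_num, by norm_num, by norm_num, 10, fun n hn => ?_⟩
    obtain ⟨P, D, s, t, k, h₁, h₂, h₃, h₄, h₅, h₆, h₇, h₈, h₉, h⟩ := MinLink.exists_polygon n hn
  · exact ⟨P, D, s, t, k, h₁, h₂, h₃, h₄, h₆, h₇, h₈, (h _ subset_rfl).1, h₉, (h _ subset_rfl).2⟩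
  · exact ⟨P, D, s, t, k, h₁, h₂, h₅ h₃, h₅ h₄, h₆, h₇, h₈, (h _ h₅).1, h₉, (h _ h₅).2⟩
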